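/- Let $K$ be any field, $R=K[X_1,\dots,X_n]$ with its standard $\mathbb Z^n$-grading ($\deg X_i=e_i$), and let $M$ be a $\mathbb Z^n$-graded $R$-module. A Stanley decomposition of $M$ is a finite direct sum decomposition $M=\bigoplus_{i=1}^r m_iK[Z_i]$ of $K$-vector spaces, where each $m_i\in M$ is homogeneous, $Z_i\subseteq\{X_1,\dots,X_n\}$, and $K[Z_i]\cap\operatorname{Ann} m_i=0$. A Hilbert decomposition of $M$ is a finite family $(K[Z_i],a_i)_{i=1}^r$ with $Z_i\subseteq\{X_1,\dots,X_n\}$ and $a_i\in\mathbb Z^n$ such that $M\cong\bigoplus_{i=1}^r K[Z_i](-a_i)$ as $\mathbb Z^n$-graded $K$-vector spaces. The Stanley depth $\operatorname{sdepth}M$ (respectively the multigraded Hilbert depth $\operatorname{hdepth}M$) is the largest value of $\min_i|Z_i|$ over all Stanley (respectively Hilbert) decompositions of $M$. Let $n=6$ and let $I=\mathfrak m=(X_1,\dots,X_6)\subset R$. Then $$\operatorname{sdepth}(R\oplus I)=\operatorname{hdepth}(R\oplus I)=4,\qquad \operatorname{sdepth}(I)=\operatorname{hdepth}(I)=3 .$$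 Consequently, over every field $K$, the answer to Herzog's question whether $\operatorname{sdepth}(R\oplus I)=\operatorname{sdepth}I$ for all $n$ and all nonzero monomial ideals $I\subseteq R$ is negative. -/

import Mathlib

noncomputable section

namespace Multigraded

open MvPolynomial DirectSum

/-- The degree-`a` component of `K[X₁, …, Xₙ]` in its standard `ℤⁿ`-grading, in which `X i` has
degree the `i`-th unit vector. -/
def polyPiece (K : Type*) [Field K] (n : ℕ) (a : Fin n → ℤ) :
    Submodule K (MvPolynomial (Fin n) K) :=
  weightedHomogeneousSubmodule K (fun i : Fin n => (Pi.single i 1 : Fin n → ℤ)) a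

/-- A `ℤⁿ`-grading of a module `M` over `R = K[X₁, …, Xₙ]`:
`M = ⨁ M_a` over `K`, with `R_b M_a ⊆ M_{b + a}`. -/
structure Grading (K : Type*) [Field K] (n : ℕ) (M : Type*) [AddCommGroup M] [Module K M]
    [Module (MvPolynomial (Fin n) K) M] where
  piece : (Fin n → ℤ) → Submodule K M
  isInternal : IsInternal piece
  smul_mem : ∀ (b a : Fin n → ℤ) (f : MvPolynomial (Fin n) K) (x : M),
    f ∈ polyPiece K n b → x ∈ piece a → f • x ∈ piece (b + a)

section Depth

variable {K : Type*} [Field K] {n : ℕ} {M : Type*} [AddCommGroup M] [Module K M]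
  [Module (MvPolynomial (Fin n) K) M] [IsScalarTower K (MvPolynomial (Fin n) K) M]

/-- The `K`-subspace `m K[Z]` of `M`, where `K[Z]` is the subalgebra generated by the
indeterminates `X j`, `j ∈ Z`. -/
def stanleySpace (m : M) (Z : Finset (Fin n)) : Submodule K M :=
  (Subalgebra.toSubmodule (supported K (Z : Set (Fin n)))).map
    ((LinearMap.toSpanSingleton (MvPolynomial (Fin n) K) M m).restrictScalars K)

/-- A Stanley decomposition `M = ⨁ mᵢ K[Zᵢ]` (a finite direct sum of vector spaces), with `mᵢ`
homogeneous and `K[Zᵢ] ∩ Ann mᵢ = 0`. -/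
structure StanleyDecomposition (G : Grading K n M) where
  len : ℕ
  gen : Fin len → M
  vars : Fin len → Finset (Fin n)
  homogeneous : ∀ i, ∃ a, gen i ∈ G.piece a
  ann_inf : ∀ i, ∀ f ∈ supported K (vars i : Set (Fin n)), f • gen i = 0 → f = 0
  isInternal : IsInternal fun i => (stanleySpace (gen i) (vars i) : Submodule K M)

/-- The least number of indeterminates of the subalgebras `K[Zᵢ]` involved
(`⊤` for the empty decomposition). -/
def StanleyDecomposition.depth {G : Grading K n M} (D : StanleyDecomposition G) : ℕ∞ :=
  ⨅ i, ((D.vars i).card : ℕ∞)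

/-- The Stanley depth: the largest depth of a Stanley decomposition. -/
def sdepth (G : Grading K n M) : ℕ∞ :=
  ⨆ D : StanleyDecomposition G, D.depth

/-- A Hilbert decomposition: a finite family of shifted polynomial subalgebras `K[Zᵢ](-aᵢ)` with
`M ≅ ⨁ K[Zᵢ](-aᵢ)` as `ℤⁿ`-graded `K`-vector spaces, where
`K[Z](-s)` has as its component of degree `a` the component of `K[Z]` of degree `a - s`. -/
structure HilbertDecomposition (G : Grading K n M) where
  len : ℕ
  shift : Fin len → (Fin n → ℤ)
  vars : Fin len → Finset (Fin n)
  exists_gradedEquiv :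
    ∃ e : M ≃ₗ[K] ⨁ i, (supported K (vars i : Set (Fin n))),
      ∀ (a : Fin n → ℤ) (x : M), x ∈ G.piece a ↔
        ∀ i, ((e x i : supported K (vars i : Set (Fin n))) : MvPolynomial (Fin n) K) ∈
          polyPiece K n (a - shift i)

/-- The least number of indeterminates of the subalgebras `K[Zᵢ]` involved
(`⊤` for the empty decomposition). -/
def HilbertDecomposition.depth {G : Grading K n M} (D : HilbertDecomposition G) : ℕ∞ :=
  ⨅ i, ((D.vars i).card : ℕ∞)

/-- The (multigraded) Hilbert depth: the largest depth of a Hilbert decomposition. -/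
def hdepth (G : Grading K n M) : ℕ∞ :=
  ⨆ D : HilbertDecomposition G, D.depth

end Depth

section Constructions

variable {K : Type*} [Field K] {n : ℕ}

theorem polyPiece_isInternal : IsInternal (polyPiece K n) := by
  classical
  exact (weightedDecomposition K (fun i : Fin n => (Pi.single i 1 : Fin n → ℤ))).isInternal

theorem polyPiece_mul_mem (b a : Fin n → ℤ) (f g : MvPolynomial (Fin n) K)
    (hf : f ∈ polyPiece K n b) (hg : g ∈ polyPiece K n a) : f * g ∈ polyPiece K n (b + a) :=
  IsWeightedHomogeneous.mul hf hg

theorem monomial_mem_polyPiece (d : Fin n →₀ ℕ) (c : K) :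
    monomial d c ∈ polyPiece K n
      (Finsupp.weight (fun i : Fin n => (Pi.single i 1 : Fin n → ℤ)) d) :=
  isWeightedHomogeneous_monomial _ _ _ rfl

theorem eq_zero_of_mem_inf {ι M N : Type*} [AddCommGroup M] [Module K M] [AddCommGroup N]
    [Module K N] {P : ι → Submodule K M} {Q : ι → Submodule K N} (hQ : iSupIndep Q)
    (f : M →ₗ[K] N) (h : ∀ a, P a ≤ (Q a).comap f) (a : ι) (x : M) (hx : x ∈ P a)
    (hx' : x ∈ ⨆ j, ⨆ (_ : j ≠ a), P j) : f x = 0 := by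
  have h2 : (⨆ j, ⨆ (_ : j ≠ a), P j) ≤ (⨆ j, ⨆ (_ : j ≠ a), Q j).comap f :=
    iSup₂_le fun j hj => (h j).trans (Submodule.comap_mono (le_iSup₂_of_le j hj le_rfl))
  exact Submodule.disjoint_def.1 (hQ a) _ (h a hx) (h2 hx')

/-- A monomial ideal: an ideal generated by monomials. -/
def IsMonomialIdeal (I : Ideal (MvPolynomial (Fin n) K)) : Prop :=
  ∃ S : Set (Fin n →₀ ℕ), I = Ideal.span ((fun d => monomial d (1 : K)) '' S)

/-- The grading `I_a = I ∩ R_a` of a monomial ideal. -/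
def idealGrading (I : Ideal (MvPolynomial (Fin n) K)) (hI : IsMonomialIdeal I) :
    Grading K n I where
  piece a := (polyPiece K n a).comap (I.subtype.restrictScalars K)
  isInternal := by
    classical
    refine isInternal_submodule_of_iSupIndep_of_iSup_eq_top ?_ ?_
    · intro a
      refine Submodule.disjoint_def.2 fun x hx hx' => ?_
      exact Subtype.ext (eq_zero_of_mem_inf polyPiece_isInternal.submodule_iSupIndep
        (I.subtype.restrictScalars K) (fun _ => le_rfl) a x hx hx')
    · obtain ⟨S, rfl⟩ := hI
      refine eq_top_iff.2 fun x _ => ?_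
      have hm : ∀ d ∈ x.1.support, monomial d (coeff d x.1) ∈
          Ideal.span ((fun d => monomial d (1 : K)) '' S) := by
        intro d hd
        have hx := x.2
        rw [mem_ideal_span_monomial_image] at hx
        refine mem_ideal_span_monomial_image.2 ?_
        intro e he
        have : e = d := by
          simpa using support_monomial_subset he
        subst this
        exact hx e hd
      have hx : x = ∑ d ∈ x.1.support.attach,
          (⟨monomial d.1 (coeff d.1 x.1), hm d.1 d.2⟩ :
            Ideal.span ((fun d => monomial d (1 : K)) '' S)) := by
        apply Subtype.ext
        rw [AddSubmonoidClass.coe_finsetSum]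
        conv_lhs => rw [x.1.as_sum]
        exact (Finset.sum_attach x.1.support fun d => monomial d (coeff d x.1)).symm
      rw [hx]
      exact Submodule.sum_mem _ fun d _ => Submodule.mem_iSup_of_mem _
        (monomial_mem_polyPiece d.1 (coeff d.1 x.1))
  smul_mem b a f x hf hx := polyPiece_mul_mem b a f x.1 hf hx

/-- The standard `ℤⁿ`-grading of `R = K[X₁, …, Xₙ]` itself. -/
def polyGrading (K : Type*) [Field K] (n : ℕ) : Grading K n (MvPolynomial (Fin n) K) where
  piece := polyPiece K n
  isInternal := polyPiece_isInternal
  smul_mem := polyPiece_mul_mem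

/-- The direct sum of graded modules: `(M ⊕ N)_a = M_a ⊕ N_a`. -/
def Grading.prod {M N : Type*} [AddCommGroup M] [Module K M] [Module (MvPolynomial (Fin n) K) M]
    [AddCommGroup N] [Module K N] [Module (MvPolynomial (Fin n) K) N]
    (G : Grading K n M) (H : Grading K n N) : Grading K n (M × N) where
  piece a := (G.piece a).prod (H.piece a)
  isInternal := by
    classical
    refine isInternal_submodule_of_iSupIndep_of_iSup_eq_top ?_ ?_
    · intro a
      refine Submodule.disjoint_def.2 fun x hx hx' => Prod.ext ?_ ?_
      · exact eq_zero_of_mem_inf (P := fun a => (G.piece a).prod (H.piece a))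
          G.isInternal.submodule_iSupIndep (LinearMap.fst K M N) (fun _ _ h => h.1) a x hx hx'
      · exact eq_zero_of_mem_inf (P := fun a => (G.piece a).prod (H.piece a))
          H.isInternal.submodule_iSupIndep (LinearMap.snd K M N) (fun _ _ h => h.2) a x hx hx'
    · have h1 : (⊤ : Submodule K M) ≤
          (⨆ a, (G.piece a).prod (H.piece a)).comap (LinearMap.inl K M N) := by
        rw [← G.isInternal.submodule_iSup_eq_top]
        exact iSup_le fun a x hx => Submodule.mem_iSup_of_mem a ⟨hx, (H.piece a).zero_mem⟩
      have h2 : (⊤ : Submodule K N) ≤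
          (⨆ a, (G.piece a).prod (H.piece a)).comap (LinearMap.inr K M N) := by
        rw [← H.isInternal.submodule_iSup_eq_top]
        exact iSup_le fun a x hx => Submodule.mem_iSup_of_mem a ⟨(G.piece a).zero_mem, hx⟩
      refine eq_top_iff.2 fun x _ => ?_
      have h := Submodule.add_mem (⨆ a, (G.piece a).prod (H.piece a))
        (h1 (Submodule.mem_top (x := x.1))) (h2 (Submodule.mem_top (x := x.2)))
      simpa using h
  smul_mem b a f x hf hx := ⟨G.smul_mem b a f x.1 hf hx.1, H.smul_mem b a f x.2 hf hx.2⟩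

/-- The graded maximal ideal `m = (X₁, …, Xₙ)`. -/
def maxIdeal (K : Type*) [Field K] (n : ℕ) : Ideal (MvPolynomial (Fin n) K) :=
  Ideal.span (Set.range X)

theorem maxIdeal_isMonomialIdeal (K : Type*) [Field K] (n : ℕ) :
    IsMonomialIdeal (maxIdeal K n) := by
  refine ⟨Set.range fun i => Finsupp.single i 1, ?_⟩
  rw [← Set.range_comp]
  rfl

end Constructions

end Multigraded

end

noncomputable section

namespace Multigraded

open MvPolynomial DirectSum

/-! ### Graded pieces of the polynomial subalgebras `K[Z]` -/

section Pieces

variable {K : Type*} [Field K] {n : ℕ}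

/-! Every Stanley decomposition is a Hilbert decomposition with the same sets `Zᵢ`, so `sdepth ≤
hdepth`, and it suffices to bound `hdepth` from above and `sdepth` from below.

Upper bounds. A Hilbert decomposition writes the Hilbert function `H` of the module as a sum of
those of the `K[Z](-s)`, all with `s ≥ 0`. Let `U` be the sum of `H` over the unit vectors and `P`
its sum over the sums of two distinct unit vectors. If `z = |Z| ≥ c + 1`, then each summand
satisfies `c U ≤ P + (c(c+1)/2) H(0)`. For `s = 0` the difference of the two sides is `(z - c)(z - c
- 1)/2`; for a unit vector `s`, `U = 1` and `P ≥ z - 1`; for any other `s`, `U = 0`. Summing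
(`HilbertDecomposition.mul_sumUnits_le`) gives the inequality for the module. It fails for `m` with
`c = 3` (`18 ≤ 15`) and for `R ⊕ m` with `c = 4` (`48 ≤ 40`).

Lower bounds. A monomial lies in `x^A K[B]`, with `A ⊆ B`, exactly when its support lies in the
interval `[A, B]`. A partition of the nonempty subsets into intervals with `|B| ≥ 3` therefore
decomposes `m`. For `R ⊕ m`, whose pieces in nonzero nonnegative degrees are planes, the generators
are `x^A v` with `v` in `K²`. Intervals with `|B| ≥ 4` cover each nonempty subset twice, with
different vectors among `(1,0)`, `(0,1)`, `(1,1)`. These are pairwise independent over every field,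
so the characteristic plays no role. -/

theorem weight_single_one_apply (d : Fin n →₀ ℕ) (i : Fin n) :
    Finsupp.weight (fun i : Fin n => (Pi.single i 1 : Fin n → ℤ)) d i = (d i : ℤ) := by
  classical
  rw [Finsupp.weight_apply, Finsupp.sum_fintype _ _ (by simp), Finset.sum_apply]
  simp [Pi.single_apply]

theorem mem_polyPiece {a : Fin n → ℤ} {f : MvPolynomial (Fin n) K} :
    f ∈ polyPiece K n a ↔ ∀ d, coeff d f ≠ 0 → ∀ i, (d i : ℤ) = a i := by
  refine forall₂_congr fun d _ => ?_
  rw [funext_iff]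
  simp only [weight_single_one_apply]

theorem mem_supported_iff_coeff {Z : Finset (Fin n)} {f : MvPolynomial (Fin n) K} :
    f ∈ supported K (Z : Set (Fin n)) ↔ ∀ d, coeff d f ≠ 0 → d.support ⊆ Z := by
  rw [mem_supported]
  constructor
  · intro h d hd i hi
    exact h ((mem_vars_iff_mem_support i).2 ⟨d, mem_support_iff.2 hd, hi⟩)
  · intro h i hi
    obtain ⟨d, hd, hi⟩ := (mem_vars_iff_mem_support i).1 hi
    exact h d (mem_support_iff.1 hd) hi

theorem monomial_mem_supported {Z : Finset (Fin n)} {d : Fin n →₀ ℕ} (hd : d.support ⊆ Z)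
    (c : K) : monomial d c ∈ supported K (Z : Set (Fin n)) := by
  refine mem_supported_iff_coeff.2 fun e he => ?_
  rw [coeff_monomial] at he
  obtain rfl : d = e := by
    by_contra h
    simp [h] at he
  exact hd

/-- The degree-`b` component of the subalgebra `K[Z]`. -/
def supportedPiece (K : Type*) [Field K] {n : ℕ} (Z : Finset (Fin n)) (b : Fin n → ℤ) :
    Submodule K (supported K (Z : Set (Fin n))) :=
  (polyPiece K n b).comap (supported K (Z : Set (Fin n))).val.toLinearMap

theorem mem_supportedPiece {Z : Finset (Fin n)} {b : Fin n → ℤ}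
    {f : supported K (Z : Set (Fin n))} :
    f ∈ supportedPiece K Z b ↔ (f : MvPolynomial (Fin n) K) ∈ polyPiece K n b := Iff.rfl

/-- Whether `b` is the degree of a monomial in the indeterminates `X j`, `j ∈ Z`. -/
def IsDegree (Z : Finset (Fin n)) (b : Fin n → ℤ) : Prop :=
  ∀ j, 0 ≤ b j ∧ (j ∉ Z → b j = 0)

instance (Z : Finset (Fin n)) (b : Fin n → ℤ) : Decidable (IsDegree Z b) :=
  inferInstanceAs (Decidable (∀ j, 0 ≤ b j ∧ (j ∉ Z → b j = 0)))

theorem supportedPiece_eq_bot {Z : Finset (Fin n)} {b : Fin n → ℤ} (hb : ¬ IsDegree Z b) :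
    supportedPiece K Z b = ⊥ := by
  refine (Submodule.eq_bot_iff _).2 fun f hf => Subtype.ext ?_
  ext d
  by_contra hd
  have h1 := mem_polyPiece.1 hf d hd
  have h2 := mem_supported_iff_coeff.1 f.2 d hd
  refine hb fun j => ⟨by rw [← h1 j]; positivity, fun hj => ?_⟩
  rw [← h1 j]
  have : d j = 0 := by
    by_contra h
    exact hj (h2 (Finsupp.mem_support_iff.2 h))
  exact_mod_cast this

/-- The monomial of degree `b`. -/
def expOf (b : Fin n → ℤ) : Fin n →₀ ℕ := Finsupp.equivFunOnFinite.symm fun j => (b j).toNat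

theorem coe_expOf {Z : Finset (Fin n)} {b : Fin n → ℤ} (hb : IsDegree Z b) (j : Fin n) :
    (expOf b j : ℤ) = b j := Int.toNat_of_nonneg (hb j).1

theorem expOf_support {Z : Finset (Fin n)} {b : Fin n → ℤ} (hb : IsDegree Z b) :
    (expOf b).support ⊆ Z := by
  intro j hj
  by_contra h
  refine Finsupp.mem_support_iff.1 hj ?_
  have := coe_expOf hb j
  rw [(hb j).2 h] at this
  exact_mod_cast this

theorem supportedPiece_eq_span {Z : Finset (Fin n)} {b : Fin n → ℤ} (hb : IsDegree Z b) :
    supportedPiece K Z b =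
      K ∙ (⟨monomial (expOf b) 1, monomial_mem_supported (expOf_support hb) 1⟩ :
        supported K (Z : Set (Fin n))) := by
  refine le_antisymm (fun f hf => ?_) ?_
  · refine Submodule.mem_span_singleton.2 ⟨coeff (expOf b) f.1, Subtype.ext ?_⟩
    change coeff (expOf b) f.1 • monomial (expOf b) (1 : K) = f.1
    ext d
    rw [coeff_smul, coeff_monomial, smul_eq_mul]
    split_ifs with h
    · rw [mul_one, h]
    · rw [mul_zero]
      by_contra h2
      refine h (Finsupp.ext fun j => ?_)
      have h3 := mem_polyPiece.1 hf d (Ne.symm h2) j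
      rw [← coe_expOf hb j] at h3
      exact_mod_cast h3.symm
  · rw [Submodule.span_singleton_le_iff_mem, mem_supportedPiece, mem_polyPiece]
    intro d hd j
    rw [coeff_monomial] at hd
    obtain rfl : expOf b = d := by
      by_contra h
      simp [h] at hd
    exact coe_expOf hb j

instance (Z : Finset (Fin n)) (b : Fin n → ℤ) : Module.Free K (supportedPiece K Z b) :=
  @Module.Free.of_divisionRing K (supportedPiece K Z b) _ (Submodule.addCommGroup _) _

instance (Z : Finset (Fin n)) (b : Fin n → ℤ) : Module.Finite K (supportedPiece K Z b) := by
  by_cases hb : IsDegree Z b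
  · rw [supportedPiece_eq_span hb]
    infer_instance
  · rw [supportedPiece_eq_bot hb]
    infer_instance

theorem finrank_supportedPiece (Z : Finset (Fin n)) (b : Fin n → ℤ) :
    Module.finrank K (supportedPiece K Z b) = if IsDegree Z b then 1 else 0 := by
  split_ifs with hb
  · rw [supportedPiece_eq_span hb, finrank_span_singleton]
    intro h
    have := congrArg Subtype.val h
    simp [monomial_eq_zero] at this
  · rw [supportedPiece_eq_bot hb, finrank_bot]

theorem iSup_supportedPiece (Z : Finset (Fin n)) (s : Fin n → ℤ) :
    ⨆ a, supportedPiece K Z (a - s) = ⊤ := by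
  refine eq_top_iff.2 fun f _ => ?_
  have hf : f = ∑ d ∈ f.1.support.attach,
      (⟨monomial d.1 (coeff d.1 f.1), monomial_mem_supported
        (mem_supported_iff_coeff.1 f.2 d.1 (mem_support_iff.1 d.2)) _⟩ :
        supported K (Z : Set (Fin n))) := by
    apply Subtype.ext
    rw [AddSubmonoidClass.coe_finsetSum]
    conv_lhs => rw [f.1.as_sum]
    exact (Finset.sum_attach f.1.support fun d => monomial d (coeff d f.1)).symm
  rw [hf]
  refine Submodule.sum_mem _ fun d _ => Submodule.mem_iSup_of_mem
    (Finsupp.weight (fun i : Fin n => (Pi.single i 1 : Fin n → ℤ)) d.1 + s) ?_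
  rw [mem_supportedPiece, add_sub_cancel_right]
  exact monomial_mem_polyPiece _ _

end Pieces

/-- An injective map that sends spanning pieces into independent ones also reflects membership: the
part of `x` outside `P a` is mapped both into `Q a` and into the span of the other `Q j`, hence
vanishes. This upgrades the one-sided grading condition to the equivalence required of a Hilbert
decomposition. -/
theorem mem_iff_of_iSupIndep {K ι M N : Type*} [Field K] [AddCommGroup M] [Module K M]
    [AddCommGroup N] [Module K N] {P : ι → Submodule K M} {Q : ι → Submodule K N}
    (hP : ⨆ a, P a = ⊤) (hQ : iSupIndep Q) (f : M →ₗ[K] N) (hf : Function.Injective f)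
    (h : ∀ a, P a ≤ (Q a).comap f) (a : ι) (x : M) : f x ∈ Q a ↔ x ∈ P a := by
  refine ⟨fun hx => ?_, fun hx => h a hx⟩
  have h1 : x ∈ P a ⊔ ⨆ j, ⨆ (_ : j ≠ a), P j := by
    have h2 : ⨆ j, P j ≤ P a ⊔ ⨆ j, ⨆ (_ : j ≠ a), P j := by
      refine iSup_le fun j => ?_
      by_cases hj : j = a
      · exact hj ▸ le_sup_left
      · exact le_sup_of_le_right (le_iSup₂_of_le j hj le_rfl)
    exact h2 (hP ▸ Submodule.mem_top)
  obtain ⟨p, hp, r, hr, rfl⟩ := Submodule.mem_sup.1 h1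
  have h2 : (⨆ j, ⨆ (_ : j ≠ a), P j) ≤ (⨆ j, ⨆ (_ : j ≠ a), Q j).comap f :=
    iSup₂_le fun j hj => (h j).trans (Submodule.comap_mono (le_iSup₂_of_le j hj le_rfl))
  have h3 : f r ∈ Q a := by
    have := (Q a).sub_mem hx (h a hp)
    rwa [map_add, add_sub_cancel_left] at this
  have h4 : r = 0 := hf (by rw [Submodule.disjoint_def.1 (hQ a) _ h3 (h2 hr), map_zero])
  rwa [h4, add_zero]

/-! ### Stanley decompositions, Hilbert decompositions and Hilbert functions -/

section Depth

variable {K : Type*} [Field K] {n : ℕ} {M : Type*} [AddCommGroup M] [Module K M]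
  [Module (MvPolynomial (Fin n) K) M] [IsScalarTower K (MvPolynomial (Fin n) K) M]

/-- Multiplication `K[Z] → m K[Z]`, `f ↦ f m`. -/
def toStanleySpace (m : M) (Z : Finset (Fin n)) :
    supported K (Z : Set (Fin n)) →ₗ[K] (stanleySpace m Z : Submodule K M) :=
  LinearMap.codRestrict _
    (((LinearMap.toSpanSingleton (MvPolynomial (Fin n) K) M m).restrictScalars K).comp
      (supported K (Z : Set (Fin n))).val.toLinearMap)
    fun f => Submodule.mem_map_of_mem f.2

theorem toStanleySpace_apply (m : M) (Z : Finset (Fin n)) (f : supported K (Z : Set (Fin n))) :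
    (toStanleySpace m Z f : M) = (f : MvPolynomial (Fin n) K) • m := rfl

theorem toStanleySpace_bijective (m : M) (Z : Finset (Fin n))
    (h : ∀ f ∈ supported K (Z : Set (Fin n)), f • m = 0 → f = 0) :
    Function.Bijective (toStanleySpace (K := K) m Z) := by
  refine ⟨(injective_iff_map_eq_zero _).2 fun f hf => Subtype.ext (h f.1 f.2 ?_), ?_⟩
  · rw [← toStanleySpace_apply, hf]
    rfl
  · rintro ⟨_, f, hf, rfl⟩
    exact ⟨⟨f, hf⟩, rfl⟩

/-- A Stanley decomposition induces a Hilbert decomposition of the same depth. -/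
theorem StanleyDecomposition.exists_hilbertDecomposition {G : Grading K n M}
    (D : StanleyDecomposition G) : ∃ H : HilbertDecomposition G, H.depth = D.depth := by
  classical
  choose s hs using D.homogeneous
  let ψ := fun i => LinearEquiv.ofBijective (toStanleySpace (K := K) (D.gen i) (D.vars i))
    (toStanleySpace_bijective _ _ (D.ann_inf i))
  let E : (⨁ i, (supported K (D.vars i : Set (Fin n)))) ≃ₗ[K] M :=
    (DFinsupp.mapRange.linearEquiv ψ).trans
      (LinearEquiv.ofBijective (coeLinearMap _) D.isInternal)
  have hE : ∀ y, E y = ∑ i, (y i : MvPolynomial (Fin n) K) • D.gen i := by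
    intro y
    change coeLinearMap _ (DFinsupp.mapRange.linearEquiv ψ y) = _
    rw [DirectSum.coeLinearMap_eq_dfinsuppSum, DFinsupp.sum_eq_sum_fintype]
    · rfl
    · simp
  -- `P a` is the degree-`a` component of `⨁ K[Zᵢ](-sᵢ)`, where `sᵢ` is the degree of the `i`-th
  -- generator.
  let P : (Fin n → ℤ) → Submodule K (⨁ i, (supported K (D.vars i : Set (Fin n)))) :=
    fun a => ⨅ i, (supportedPiece K (D.vars i) (a - s i)).comap (component K _ _ i)
  have hP : ∀ a y, y ∈ P a ↔ ∀ i, (y i : MvPolynomial (Fin n) K) ∈ polyPiece K n (a - s i) := by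
    intro a y
    simp only [P, Submodule.mem_iInf]
    rfl
  have hPtop : ⨆ a, P a = ⊤ := by
    refine eq_top_iff.2 fun y _ => ?_
    induction y using DirectSum.induction_on with
    | zero => exact Submodule.zero_mem _
    | add x y hx hy => exact Submodule.add_mem _ (hx trivial) (hy trivial)
    | of i f =>
      have h1 : (⊤ : Submodule K (supported K (D.vars i : Set (Fin n)))) ≤
          (⨆ a, P a).comap (lof K _ _ i) := by
        rw [← iSup_supportedPiece (D.vars i) (s i)]
        refine iSup_le fun a f hf => Submodule.mem_iSup_of_mem a ((hP _ _).2 fun j => ?_)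
        by_cases hj : i = j
        · subst hj
          rw [lof_apply]
          exact hf
        · rw [lof_eq_of, of_eq_of_ne _ _ _ (Ne.symm hj)]
          exact Submodule.zero_mem _
      exact h1 (Submodule.mem_top (x := f))
  have hPG : ∀ a, P a ≤ (G.piece a).comap E.toLinearMap := by
    intro a y hy
    change E y ∈ G.piece a
    rw [hE]
    refine Submodule.sum_mem _ fun i _ => ?_
    have := G.smul_mem _ _ _ _ ((hP a y).1 hy i) (hs i)
    rwa [sub_add_cancel] at this
  refine ⟨⟨D.len, s, D.vars, E.symm, fun a x => ?_⟩, rfl⟩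
  have := mem_iff_of_iSupIndep hPtop G.isInternal.submodule_iSupIndep E.toLinearMap
    E.injective hPG a (E.symm x)
  rw [← hP, ← this]
  simp

theorem sdepth_le_hdepth (G : Grading K n M) : sdepth G ≤ hdepth G := by
  refine iSup_le fun D => ?_
  obtain ⟨H, hH⟩ := D.exists_hilbertDecomposition
  exact hH ▸ le_iSup (fun H : HilbertDecomposition G => H.depth) H

omit [IsScalarTower K (MvPolynomial (Fin n) K) M] in
/-- The Hilbert function of a module with a Hilbert decomposition. -/
theorem HilbertDecomposition.finrank_piece {G : Grading K n M} (D : HilbertDecomposition G)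
    (a : Fin n → ℤ) : Module.finrank K (G.piece a) =
      ∑ i, if IsDegree (D.vars i) (a - D.shift i) then 1 else 0 := by
  classical
  obtain ⟨e, he⟩ := D.exists_gradedEquiv
  -- The graded isomorphism restricts to degree `a`; surjectivity uses the converse direction of
  -- `he`.
  let F : G.piece a →ₗ[K] ∀ i, supportedPiece K (D.vars i) (a - D.shift i) :=
    LinearMap.pi fun i => LinearMap.codRestrict _
      ((component K _ _ i).comp (e.toLinearMap.comp (G.piece a).subtype))
      fun x => (he a x.1).1 x.2 i
  have hF : Function.Bijective F := by
    constructor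
    · intro x y hxy
      refine Subtype.ext (e.injective (DFinsupp.ext fun i => ?_))
      exact congrArg Subtype.val (congrFun hxy i)
    · intro y
      let z : ⨁ i, (supported K (D.vars i : Set (Fin n))) :=
        DFinsupp.equivFunOnFintype.symm fun i => (y i).1
      have hz : ∀ i, z i = (y i).1 := fun i => rfl
      refine ⟨⟨e.symm z, (he a _).2 fun i => ?_⟩, funext fun i => Subtype.ext ?_⟩
      · rw [e.apply_symm_apply, hz]
        exact (y i).2
      · change e (e.symm z) i = (y i).1
        rw [e.apply_symm_apply, hz]
  rw [(LinearEquiv.ofBijective F hF).finrank_eq, Module.finrank_pi_fintype]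
  simp only [finrank_supportedPiece]

omit [IsScalarTower K (MvPolynomial (Fin n) K) M] in
theorem lt_card_vars_of_lt_depth {G : Grading K n M} {D : HilbertDecomposition G} {t : ℕ}
    (h : (t : ℕ∞) < D.depth) (i : Fin D.len) : t < (D.vars i).card := by
  exact_mod_cast h.trans_le (iInf_le _ i)

/-- A Stanley decomposition from linear independence of the spaces `mᵢ K[Zᵢ]`. -/
def StanleyDecomposition.ofSumEqZero (G : Grading K n M) {r : ℕ} (gen : Fin r → M)
    (vars : Fin r → Finset (Fin n)) (hom : ∀ i, ∃ a, gen i ∈ G.piece a)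
    (indep : ∀ f : Fin r → MvPolynomial (Fin n) K,
      (∀ i, f i ∈ supported K (vars i : Set (Fin n))) → ∑ i, f i • gen i = 0 → ∀ i, f i = 0)
    (span : ⨆ i, (stanleySpace (gen i) (vars i) : Submodule K M) = ⊤) :
    StanleyDecomposition G where
  len := r
  gen := gen
  vars := vars
  homogeneous := hom
  ann_inf i f hf h := by
    classical
    -- The annihilator condition is independence for the family with the single nonzero entry `f`.
    have := indep (Pi.single i f) (fun j => ?_) ?_ i
    · simpa using this
    · by_cases hj : j = i
      · subst hj
        simpa using hf
      · rw [Pi.single_eq_of_ne hj]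
        exact Subalgebra.zero_mem _
    · rw [Finset.sum_eq_single i]
      · simpa using h
      · intro j _ hj
        rw [Pi.single_eq_of_ne hj, zero_smul]
      · simp
  isInternal := by
    classical
    refine isInternal_submodule_of_iSupIndep_of_iSup_eq_top ?_ span
    rw [iSupIndep_iff_finsetSum_eq_zero_imp_eq_zero]
    intro s v hv h0
    choose f hf hfv using hv
    have := indep (fun i => if h : i ∈ s then f i h else 0) (fun i => ?_) ?_
    · intro i hi
      have h1 := this i
      simp only [hi, dite_true] at h1
      rw [← hfv i hi, h1, map_zero]
    · split_ifs with h
      · exact hf i h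
      · exact Subalgebra.zero_mem _
    · rw [← h0, ← Finset.sum_subset (Finset.subset_univ s)]
      · refine Finset.sum_congr rfl fun i hi => ?_
        rw [dif_pos hi]
        exact hfv i hi
      · intro i _ hi
        rw [dif_neg hi, zero_smul]

end Depth


/-! ### Hilbert functions of `R`, `m` and `R ⊕ m` -/

section HilbertFunctions

variable {K : Type*} [Field K] {n : ℕ}

theorem map_supportedPiece_univ (a : Fin n → ℤ) :
    (supportedPiece K Finset.univ a).map
      (supported K ((Finset.univ : Finset (Fin n)) : Set (Fin n))).val.toLinearMap =
      polyPiece K n a := by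
  refine le_antisymm (Submodule.map_comap_le _ _) fun f hf => ?_
  exact ⟨⟨f, mem_supported_iff_coeff.2 fun d _ => Finset.subset_univ _⟩, hf, rfl⟩

instance (a : Fin n → ℤ) : Module.Finite K (polyPiece K n a) := by
  rw [← map_supportedPiece_univ]
  infer_instance

theorem finrank_polyPiece (a : Fin n → ℤ) :
    Module.finrank K (polyPiece K n a) = if ∀ j, 0 ≤ a j then 1 else 0 := by
  rw [← map_supportedPiece_univ, ← (Submodule.equivMapOfInjective _ Subtype.val_injective
    (supportedPiece K Finset.univ a)).finrank_eq, finrank_supportedPiece]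
  simp [IsDegree]

theorem mem_maxIdeal {f : MvPolynomial (Fin n) K} : f ∈ maxIdeal K n ↔ coeff 0 f = 0 := by
  rw [maxIdeal, ← Set.image_univ, mem_ideal_span_X_image]
  constructor
  · intro h
    by_contra h0
    obtain ⟨i, -, hi⟩ := h 0 (mem_support_iff.2 h0)
    exact hi rfl
  · intro h d hd
    by_contra! h0
    refine mem_support_iff.1 hd ?_
    rwa [show d = 0 from Finsupp.ext fun i => h0 i (Set.mem_univ i)]

theorem map_maxIdeal_piece {a : Fin n → ℤ} (ha : a ≠ 0) :
    ((idealGrading (maxIdeal K n) (maxIdeal_isMonomialIdeal K n)).piece a).map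
      ((maxIdeal K n).subtype.restrictScalars K) = polyPiece K n a := by
  refine le_antisymm (Submodule.map_comap_le _ _) fun f hf => ?_
  refine ⟨⟨f, mem_maxIdeal.2 ?_⟩, hf, rfl⟩
  by_contra h
  exact ha (funext fun i => (mem_polyPiece.1 hf 0 h i).symm)

theorem maxIdeal_piece_zero :
    (idealGrading (maxIdeal K n) (maxIdeal_isMonomialIdeal K n)).piece 0 = ⊥ := by
  refine (Submodule.eq_bot_iff _).2 fun f hf => Subtype.ext ?_
  ext d
  by_contra hd
  have h : d = 0 := by
    ext i
    have := mem_polyPiece.1 hf d hd i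
    exact Int.natCast_eq_zero.1 this
  exact hd (h ▸ mem_maxIdeal.1 f.2)

instance (a : Fin n → ℤ) : Module.Finite K
    ((idealGrading (maxIdeal K n) (maxIdeal_isMonomialIdeal K n)).piece a) := by
  by_cases ha : a = 0
  · rw [ha, maxIdeal_piece_zero]
    infer_instance
  · have e := Submodule.equivMapOfInjective ((maxIdeal K n).subtype.restrictScalars K)
      Subtype.val_injective
      ((idealGrading (maxIdeal K n) (maxIdeal_isMonomialIdeal K n)).piece a)
    rw [map_maxIdeal_piece ha] at e
    exact Module.Finite.equiv e.symm

theorem finrank_maxIdeal_piece (a : Fin n → ℤ) : Module.finrank K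
    ((idealGrading (maxIdeal K n) (maxIdeal_isMonomialIdeal K n)).piece a) =
      if a ≠ 0 ∧ ∀ j, 0 ≤ a j then 1 else 0 := by
  by_cases ha : a = 0
  · rw [ha, maxIdeal_piece_zero]
    simp
  · have e := Submodule.equivMapOfInjective ((maxIdeal K n).subtype.restrictScalars K)
      Subtype.val_injective
      ((idealGrading (maxIdeal K n) (maxIdeal_isMonomialIdeal K n)).piece a)
    rw [map_maxIdeal_piece ha] at e
    rw [e.finrank_eq, finrank_polyPiece]
    simp [ha]

theorem finrank_submodule_prod {M N : Type*} [AddCommGroup M] [Module K M] [AddCommGroup N]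
    [Module K N] (p : Submodule K M) (q : Submodule K N) [Module.Finite K p]
    [Module.Finite K q] :
    Module.finrank K (p.prod q) = Module.finrank K p + Module.finrank K q := by
  let e : p.prod q ≃ₗ[K] p × q :=
    { toFun := fun x => (⟨x.1.1, x.2.1⟩, ⟨x.1.2, x.2.2⟩)
      invFun := fun x => ⟨(x.1.1, x.2.1), x.1.2, x.2.2⟩
      map_add' := fun _ _ => rfl
      map_smul' := fun _ _ => rfl
      left_inv := fun _ => rfl
      right_inv := fun _ => rfl }
  rw [e.finrank_eq, Module.finrank_prod]

theorem finrank_poly_prod_maxIdeal_piece (a : Fin n → ℤ) : Module.finrank K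
    (((polyGrading K n).prod
      (idealGrading (maxIdeal K n) (maxIdeal_isMonomialIdeal K n))).piece a) =
      (if ∀ j, 0 ≤ a j then 1 else 0) + if a ≠ 0 ∧ ∀ j, 0 ≤ a j then 1 else 0 := by
  rw [← finrank_polyPiece (K := K) a, ← finrank_maxIdeal_piece (K := K) a]
  have : Module.Finite K ((polyGrading K n).piece a) :=
    inferInstanceAs (Module.Finite K (polyPiece K n a))
  exact finrank_submodule_prod _ _

end HilbertFunctions

/-! ### Upper bounds from degrees zero, one and two -/

section UpperBounds

/-- The value in degree `a` of the Hilbert function of `K[Z](-s)`. -/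
def hilbertValue (Z : Finset (Fin 6)) (s a : Fin 6 → ℤ) : ℕ :=
  if IsDegree Z (a - s) then 1 else 0

/-- Shifts of total degree at most one: zero and the unit vectors. -/
def smallShift (l : Option (Fin 6)) : Fin 6 → ℤ := fun j => if l = some j then 1 else 0

/-- The sum of the values of `H` at the unit vectors. -/
def sumUnits (H : (Fin 6 → ℤ) → ℕ) : ℕ := ∑ j, H (smallShift (some j))

/-- The sum of the values of `H` at the sums of two distinct unit vectors. -/
def sumPairs (H : (Fin 6 → ℤ) → ℕ) : ℕ :=
  ∑ k, ∑ j, if j < k then H (smallShift (some j) + smallShift (some k)) else 0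

-- At shift zero this is `(z - 3)(z - 4) ≥ 0` with `z = |Z|`; at a unit shift it is `3 ≤ z - 1` or
-- better.
set_option maxRecDepth 100000 in
theorem three_mul_sumUnits_smallShift_le : ∀ Z : Finset (Fin 6), 4 ≤ Z.card → ∀ l,
    3 * sumUnits (hilbertValue Z (smallShift l)) ≤ sumPairs (hilbertValue Z (smallShift l)) +
      6 * hilbertValue Z (smallShift l) (smallShift none) := by
  decide +kernel

-- The same inequality one step up: `(z - 4)(z - 5) ≥ 0` at shift zero and `4 ≤ z - 1` at a unit
-- shift.
set_option maxRecDepth 100000 in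
theorem four_mul_sumUnits_smallShift_le : ∀ Z : Finset (Fin 6), 5 ≤ Z.card → ∀ l,
    4 * sumUnits (hilbertValue Z (smallShift l)) ≤ sumPairs (hilbertValue Z (smallShift l)) +
      10 * hilbertValue Z (smallShift l) (smallShift none) := by
  decide +kernel

theorem exists_eq_smallShift {Z : Finset (Fin 6)} {s : Fin 6 → ℤ} (hs : ∀ j, 0 ≤ s j)
    {l : Option (Fin 6)} (h : IsDegree Z (smallShift l - s)) : ∃ l', s = smallShift l' := by
  have h1 : ∀ j, s j ≤ smallShift l j := fun j => sub_nonneg.1 (h j).1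
  by_cases h0 : s = smallShift none
  · exact ⟨_, h0⟩
  refine ⟨l, funext fun j => le_antisymm (h1 j) ?_⟩
  rw [smallShift]
  split_ifs with hl
  · by_contra! hj
    refine h0 (funext fun k => ?_)
    have h2 := h1 k
    have h3 := hs k
    rw [smallShift, hl] at h2
    by_cases hk : j = k
    · subst hk
      simp only [smallShift, reduceCtorEq, if_false]
      omega
    · simp only [Option.some.injEq, hk, if_false] at h2
      simp only [smallShift, reduceCtorEq, if_false]
      omega
  · exact hs j

/-- Reduces arbitrary nonnegative shifts to the finitely many small ones: for any other shift the
left side vanishes, since no unit vector is a degree of `K[Z](-s)`. -/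
theorem mul_sumUnits_le {t c d : ℕ} (h : ∀ Z : Finset (Fin 6), t ≤ Z.card → ∀ l,
    c * sumUnits (hilbertValue Z (smallShift l)) ≤ sumPairs (hilbertValue Z (smallShift l)) +
      d * hilbertValue Z (smallShift l) (smallShift none))
    {Z : Finset (Fin 6)} (hZ : t ≤ Z.card) {s : Fin 6 → ℤ} (hs : ∀ j, 0 ≤ s j) :
    c * sumUnits (hilbertValue Z s) ≤ sumPairs (hilbertValue Z s) +
      d * hilbertValue Z s (smallShift none) := by
  by_cases hl : ∃ l, s = smallShift l
  · obtain ⟨l, rfl⟩ := hl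
    exact h Z hZ l
  · have : sumUnits (hilbertValue Z s) = 0 :=
      Finset.sum_eq_zero fun j _ => if_neg fun hj => hl (exists_eq_smallShift hs hj)
    rw [this, mul_zero]
    exact Nat.zero_le _

variable {K : Type*} [Field K] {M : Type*} [AddCommGroup M] [Module K M]
  [Module (MvPolynomial (Fin 6) K) M] {G : Grading K 6 M}

theorem HilbertDecomposition.mul_sumUnits_le (D : HilbertDecomposition G)
    (hG : ∀ a, Module.finrank K (G.piece a) ≠ 0 → ∀ j, 0 ≤ a j)
    {t c d : ℕ} (h : ∀ Z : Finset (Fin 6), t ≤ Z.card → ∀ l,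
      c * sumUnits (hilbertValue Z (smallShift l)) ≤
        sumPairs (hilbertValue Z (smallShift l)) +
          d * hilbertValue Z (smallShift l) (smallShift none))
    (ht : ∀ i, t ≤ (D.vars i).card) :
    c * sumUnits (fun a => Module.finrank K (G.piece a)) ≤
      sumPairs (fun a => Module.finrank K (G.piece a)) +
        d * Module.finrank K (G.piece (smallShift none)) := by
  have hf : ∀ a, Module.finrank K (G.piece a) =
      ∑ i, hilbertValue (D.vars i) (D.shift i) a := D.finrank_piece
  -- The element `1` of `K[Zᵢ]` has degree `D.shift i`, so the module is nonzero in that degree.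
  have hs : ∀ i j, 0 ≤ D.shift i j := by
    intro i
    refine hG _ ?_
    rw [hf]
    intro h0
    have := Finset.sum_eq_zero_iff.1 h0 i (Finset.mem_univ i)
    have h1 : IsDegree (D.vars i) 0 := fun j => ⟨le_rfl, fun _ => rfl⟩
    rw [hilbertValue, sub_self, if_pos h1] at this
    exact one_ne_zero this
  have hU : sumUnits (fun a => Module.finrank K (G.piece a)) =
      ∑ i, sumUnits (hilbertValue (D.vars i) (D.shift i)) := by
    simp only [sumUnits, hf]
    exact Finset.sum_comm
  have hP : sumPairs (fun a => Module.finrank K (G.piece a)) =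
      ∑ i, sumPairs (hilbertValue (D.vars i) (D.shift i)) := by
    simp only [sumPairs, hf]
    conv_rhs => rw [Finset.sum_comm]
    refine Finset.sum_congr rfl fun k _ => ?_
    conv_rhs => rw [Finset.sum_comm]
    refine Finset.sum_congr rfl fun j _ => ?_
    split_ifs
    · rfl
    · simp
  rw [hU, hP, hf, Finset.mul_sum, Finset.mul_sum, ← Finset.sum_add_distrib]
  exact Finset.sum_le_sum fun i _ => Multigraded.mul_sumUnits_le h (ht i) (hs i)

theorem hdepth_maxIdeal_le (K : Type*) [Field K] :
    hdepth (idealGrading (maxIdeal K 6) (maxIdeal_isMonomialIdeal K 6)) ≤ 3 := by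
  refine iSup_le fun D => ?_
  by_contra! h
  have := D.mul_sumUnits_le ?_ three_mul_sumUnits_smallShift_le
    fun i => lt_card_vars_of_lt_depth (t := 3) h i
  -- Here `U = 6`, `P = 15` and `H(0) = 0`, so the inequality would read `18 ≤ 15`.
  · simp only [finrank_maxIdeal_piece] at this
    revert this
    decide +kernel
  · intro a ha
    rw [finrank_maxIdeal_piece] at ha
    by_contra h0
    simp [h0] at ha

theorem hdepth_poly_prod_maxIdeal_le (K : Type*) [Field K] :
    hdepth ((polyGrading K 6).prod
      (idealGrading (maxIdeal K 6) (maxIdeal_isMonomialIdeal K 6))) ≤ 4 := by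
  refine iSup_le fun D => ?_
  by_contra! h
  have := D.mul_sumUnits_le ?_ four_mul_sumUnits_smallShift_le
    fun i => lt_card_vars_of_lt_depth (t := 4) h i
  -- Here `U = 12`, `P = 30` and `H(0) = 1`, so the inequality would read `48 ≤ 30 + 10`.
  · simp only [finrank_poly_prod_maxIdeal_piece] at this
    revert this
    decide +kernel
  · intro a ha
    rw [finrank_poly_prod_maxIdeal_piece] at ha
    by_contra h0
    simp [h0] at ha

end UpperBounds


/-! ### Stanley decompositions from intervals of subsets -/

section Constructions

variable {K : Type*} [Field K] {n : ℕ}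

/-- The exponent vector of the squarefree monomial with support `A`. -/
def sqfreeExp (A : Finset (Fin n)) : Fin n →₀ ℕ :=
  Finsupp.equivFunOnFinite.symm fun i => if i ∈ A then 1 else 0

theorem sqfreeExp_apply (A : Finset (Fin n)) (i : Fin n) :
    sqfreeExp A i = if i ∈ A then 1 else 0 := rfl

theorem sqfreeExp_le {A : Finset (Fin n)} {c : Fin n →₀ ℕ} :
    sqfreeExp A ≤ c ↔ A ⊆ c.support := by
  refine forall_congr' fun i => ?_
  rw [sqfreeExp_apply, Finsupp.mem_support_iff]
  split_ifs with h <;> simp [h, Nat.one_le_iff_ne_zero]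

theorem sqfreeExp_eq_zero {A : Finset (Fin n)} : sqfreeExp A = 0 ↔ A = ∅ := by
  rw [← nonpos_iff_eq_zero, sqfreeExp_le, Finsupp.support_zero, Finset.subset_empty]

/-- Whether `S` lies in the interval `[A, B]` of the Boolean lattice. -/
abbrev Covers (A B S : Finset (Fin n)) : Prop := A ⊆ S ∧ S ⊆ B

theorem covers_of_coeff_ne_zero {A Z : Finset (Fin n)} (hA : A ⊆ Z)
    {f : MvPolynomial (Fin n) K} (hf : f ∈ supported K (Z : Set (Fin n))) {c : Fin n →₀ ℕ}
    (h : coeff c (f * monomial (sqfreeExp A) 1) ≠ 0) : Covers A Z c.support := by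
  rw [coeff_mul_monomial', mul_one] at h
  split_ifs at h with hc
  · refine ⟨sqfreeExp_le.1 hc, fun i hi => ?_⟩
    by_cases hiA : i ∈ A
    · exact hA hiA
    · refine mem_supported_iff_coeff.1 hf _ h ?_
      rw [Finsupp.mem_support_iff, Finsupp.tsub_apply, sqfreeExp_apply, if_neg hiA]
      exact Finsupp.mem_support_iff.1 hi
  · exact absurd rfl h

theorem sub_sqfreeExp_support {A Z : Finset (Fin n)} {c : Fin n →₀ ℕ}
    (h : Covers A Z c.support) : (c - sqfreeExp A).support ⊆ Z := by
  refine fun i hi => h.2 (Finsupp.mem_support_iff.2 fun h0 => ?_)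
  rw [Finsupp.mem_support_iff, Finsupp.tsub_apply, h0] at hi
  exact hi (Nat.zero_sub _)

theorem monomial_mul_monomial_sqfreeExp {A Z : Finset (Fin n)} {c : Fin n →₀ ℕ}
    (h : Covers A Z c.support) (t u : K) :
    monomial (c - sqfreeExp A) t * monomial (sqfreeExp A) u = monomial c (t * u) := by
  rw [monomial_mul, tsub_add_cancel_of_le (sqfreeExp_le.2 h.1)]

theorem eq_monomial_of_mem_polyPiece {a : Fin n → ℤ} {f : MvPolynomial (Fin n) K}
    (hf : f ∈ polyPiece K n a) : f = monomial (expOf a) (coeff (expOf a) f) := by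
  ext d
  rw [coeff_monomial]
  split_ifs with h
  · rw [h]
  · by_contra h2
    refine h (Finsupp.ext fun j => ?_)
    have := mem_polyPiece.1 hf d h2 j
    change (a j).toNat = d j
    omega

theorem monomial_mem_maxIdeal {c : Fin n →₀ ℕ} {β : K} (h : c = 0 → β = 0) :
    monomial c β ∈ maxIdeal K n := by
  rw [mem_maxIdeal, coeff_monomial]
  split_ifs with hc
  · exact h hc
  · rfl

/-- Multiplication by a monomial only shifts coefficients. Linear independence of Stanley spaces can
thus be tested one exponent `c` at a time, where only the intervals containing `c.support`
contribute. -/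
theorem coeff_eq_zero_of_forall {A : Finset (Fin n)} {f : MvPolynomial (Fin n) K}
    (h : ∀ c, coeff c (f * monomial (sqfreeExp A) 1) = 0) : f = 0 := by
  ext d
  have := h (d + sqfreeExp A)
  rwa [coeff_mul_monomial, mul_one] at this

/-- The Stanley decomposition of the graded maximal ideal given by an interval partition of the
nonempty subsets of `Fin n`. -/
def maxIdealStanleyDecomposition (K : Type*) [Field K] {r : ℕ} (A B : Fin r → Finset (Fin n))
    (hAB : ∀ k, A k ⊆ B k) (hA : ∀ k, A k ≠ ∅)
    (hcov : ∀ S : Finset (Fin n), S ≠ ∅ →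
      ∃ i, Covers (A i) (B i) S ∧ ∀ k, Covers (A k) (B k) S → k = i) :
    StanleyDecomposition (idealGrading (maxIdeal K n) (maxIdeal_isMonomialIdeal K n)) :=
  StanleyDecomposition.ofSumEqZero _
    (fun k => ⟨monomial (sqfreeExp (A k)) 1,
      monomial_mem_maxIdeal fun h => absurd (sqfreeExp_eq_zero.1 h) (hA k)⟩) B
    (fun _ => ⟨_, monomial_mem_polyPiece _ _⟩)
    (by
      intro f hf h0 k
      refine coeff_eq_zero_of_forall (A := A k) fun c => ?_
      by_contra hk
      have hck := covers_of_coeff_ne_zero (hAB k) (hf k) hk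
      obtain ⟨i, -, hi⟩ := hcov c.support fun h =>
        hA k (Finset.subset_empty.1 (h ▸ hck.1))
      have h1 := congrArg (fun x : maxIdeal K n => coeff c x.1) h0
      simp only [AddSubmonoidClass.coe_finsetSum, coeff_sum] at h1
      rw [Finset.sum_eq_single k] at h1
      · exact hk h1
      · intro k' _ hk'
        by_contra h2
        exact hk' ((hi k' (covers_of_coeff_ne_zero (hAB k') (hf k') h2)).trans (hi k hck).symm)
      · simp)
    (by
      rw [eq_top_iff, ← (idealGrading (maxIdeal K n)
        (maxIdeal_isMonomialIdeal K n)).isInternal.submodule_iSup_eq_top]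
      refine iSup_le fun a x hx => ?_
      have hx' := eq_monomial_of_mem_polyPiece (f := x.1) hx
      by_cases hc : expOf a = 0
      · have : x = 0 := by
          refine Subtype.ext ?_
          rw [hx', hc, mem_maxIdeal.1 x.2, monomial_zero]
          rfl
        rw [this]
        exact Submodule.zero_mem _
      · obtain ⟨i, hi, -⟩ := hcov _ fun h => hc (Finsupp.support_eq_empty.1 h)
        refine Submodule.mem_iSup_of_mem i ⟨_, monomial_mem_supported
          (sub_sqfreeExp_support hi) (coeff (expOf a) x.1), Subtype.ext ?_⟩
        refine (monomial_mul_monomial_sqfreeExp hi _ 1).trans ?_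
        rw [mul_one, ← hx'])

/-- The Stanley decomposition of `R ⊕ m` given by a family of intervals covering every nonempty
subset of `Fin n` twice, with linearly independent coefficient vectors, and the empty set once. -/
def polyProdMaxIdealStanleyDecomposition {r : ℕ} (A B : Fin r → Finset (Fin n))
    (v : Fin r → K × K) (hAB : ∀ k, A k ⊆ B k) (hA : ∀ k, A k = ∅ → (v k).2 = 0)
    (hempty : ∃ i, (v i).1 ≠ 0 ∧ Covers (A i) (B i) ∅ ∧ ∀ k, Covers (A k) (B k) ∅ → k = i)
    (hcov : ∀ S : Finset (Fin n), S ≠ ∅ → ∃ i j,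
      (v i).1 * (v j).2 - (v i).2 * (v j).1 ≠ 0 ∧ Covers (A i) (B i) S ∧
        Covers (A j) (B j) S ∧ ∀ k, Covers (A k) (B k) S → k = i ∨ k = j) :
    StanleyDecomposition ((polyGrading K n).prod
      (idealGrading (maxIdeal K n) (maxIdeal_isMonomialIdeal K n))) :=
  StanleyDecomposition.ofSumEqZero _
    (fun k => (monomial (sqfreeExp (A k)) (v k).1, ⟨monomial (sqfreeExp (A k)) (v k).2,
      monomial_mem_maxIdeal fun h => hA k (sqfreeExp_eq_zero.1 h)⟩)) B
    (fun _ => ⟨_, monomial_mem_polyPiece _ _, monomial_mem_polyPiece _ _⟩)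
    (by
      intro f hf h0 k
      refine coeff_eq_zero_of_forall (A := A k) fun c => ?_
      -- In exponent `c` the relation becomes `∑ w k • v k = 0` in `K²`, with `w k` nonzero for at
      -- most the intervals containing `c.support`.
      set w : Fin r → K := fun k => coeff c (f k * monomial (sqfreeExp (A k)) 1) with hw
      have hw0 : ∀ k, ¬ Covers (A k) (B k) c.support → w k = 0 := fun k hk =>
        not_not.1 fun h => hk (covers_of_coeff_ne_zero (hAB k) (hf k) h)
      have hwv : ∀ k (u : K), coeff c (f k * monomial (sqfreeExp (A k)) u) = w k * u := by
        intro k u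
        simp only [hw, coeff_mul_monomial']
        split_ifs <;> simp
      have h1 : ∑ k, w k * (v k).1 = 0 := by
        have := congrArg (fun x : MvPolynomial (Fin n) K × maxIdeal K n => coeff c x.1) h0
        simp only [Prod.fst_sum, coeff_sum, Prod.smul_fst, smul_eq_mul, hwv, Prod.fst_zero,
          coeff_zero] at this
        exact this
      have h2 : ∑ k, w k * (v k).2 = 0 := by
        have := congrArg (fun x : MvPolynomial (Fin n) K × maxIdeal K n => coeff c x.2.1) h0
        simp only [Prod.snd_sum, AddSubmonoidClass.coe_finsetSum, coeff_sum, Prod.smul_snd,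
          Submodule.coe_smul, smul_eq_mul, hwv, Prod.snd_zero, ZeroMemClass.coe_zero,
          coeff_zero] at this
        exact this
      change w k = 0
      by_cases hk : Covers (A k) (B k) c.support
      swap
      · exact hw0 k hk
      by_cases hc : c.support = ∅
      · obtain ⟨i, hvi, -, hi⟩ := hempty
        rw [hc] at hw0 hk
        obtain rfl := hi k hk
        rw [Finset.sum_eq_single k (fun k' _ hk' => by
          rw [hw0 k' fun h => hk' (hi k' h), zero_mul]) (by simp)] at h1
        exact (mul_eq_zero.1 h1).resolve_right hvi
      · obtain ⟨i, j, hij, -, -, hall⟩ := hcov c.support hc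
        have hne : i ≠ j := by
          rintro rfl
          exact hij (by ring)
        have hz : ∀ k', k' ≠ i ∧ k' ≠ j → w k' = 0 := fun k' hk' =>
          hw0 k' fun h => (hall k' h).elim hk'.1 hk'.2
        rw [Fintype.sum_eq_add i j hne fun k' hk' => by rw [hz k' hk', zero_mul]] at h1 h2
        -- Two terms remain, and eliminating one of them multiplies the other by the nonzero
        -- determinant.
        have hi : w i = 0 := by
          refine (mul_eq_zero.1 ?_).resolve_right hij
          linear_combination (v j).2 * h1 - (v j).1 * h2
        have hj : w j = 0 := by
          refine (mul_eq_zero.1 ?_).resolve_right hij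
          linear_combination (v i).1 * h2 - (v i).2 * h1
        rcases hall k hk with rfl | rfl
        · exact hi
        · exact hj)
    (by
      rw [eq_top_iff, ← ((polyGrading K n).prod (idealGrading (maxIdeal K n)
        (maxIdeal_isMonomialIdeal K n))).isInternal.submodule_iSup_eq_top]
      refine iSup_le fun a x hx => ?_
      have hx1 := eq_monomial_of_mem_polyPiece (f := x.1) hx.1
      have hx2 := eq_monomial_of_mem_polyPiece (f := x.2.1) hx.2
      have key : ∀ k, Covers (A k) (B k) (expOf a).support → ∀ (t : K)
          (y : MvPolynomial (Fin n) K × maxIdeal K n), y.1 = monomial (expOf a) (t * (v k).1) →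
          y.2.1 = monomial (expOf a) (t * (v k).2) → y ∈ ⨆ i, (stanleySpace
            ((monomial (sqfreeExp (A i)) (v i).1, ⟨monomial (sqfreeExp (A i)) (v i).2,
              monomial_mem_maxIdeal fun h => hA i (sqfreeExp_eq_zero.1 h)⟩) :
              MvPolynomial (Fin n) K × maxIdeal K n) (B i) : Submodule K _) := by
        intro k hk t y hy1 hy2
        refine Submodule.mem_iSup_of_mem k ⟨_, monomial_mem_supported
          (sub_sqfreeExp_support hk) t, Prod.ext ?_ (Subtype.ext ?_)⟩
        · exact (monomial_mul_monomial_sqfreeExp hk _ _).trans hy1.symm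
        · exact (monomial_mul_monomial_sqfreeExp hk _ _).trans hy2.symm
      by_cases hc : expOf a = 0
      · obtain ⟨i, hvi, hi, -⟩ := hempty
        -- At the zero exponent the component in `m` vanishes, and so does `(v i).2`, because the
        -- interval begins at the empty set. One generator therefore suffices.
        refine key i (by rwa [hc]) (coeff (expOf a) x.1 / (v i).1) x ?_ ?_
        · rwa [div_mul_cancel₀ _ hvi]
        · rw [hx2, hc, mem_maxIdeal.1 x.2.2, hA i (Finset.subset_empty.1 hi.1), mul_zero]
      · obtain ⟨i, j, hij, hi, hj, -⟩ := hcov _ fun h => hc (Finsupp.support_eq_empty.1 h)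
        set α := coeff (expOf a) x.1
        set β := coeff (expOf a) x.2.1
        set δ := (v i).1 * (v j).2 - (v i).2 * (v j).1
        -- Cramer's rule for `(α, β) = s • v i + t • v j`.
        set s := (α * (v j).2 - β * (v j).1) / δ with hs
        set t := (β * (v i).1 - α * (v i).2) / δ with ht
        have hα : α = s * (v i).1 + t * (v j).1 := by
          rw [hs, ht]
          field_simp
          ring
        have hβ : β = s * (v i).2 + t * (v j).2 := by
          rw [hs, ht]
          field_simp
          ring
        have hm : ∀ u : K, monomial (expOf a) u ∈ maxIdeal K n := fun u =>
          monomial_mem_maxIdeal fun h => absurd h hc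
        have hsum : x = (monomial (expOf a) (s * (v i).1), ⟨_, hm (s * (v i).2)⟩) +
            (monomial (expOf a) (t * (v j).1), ⟨_, hm (t * (v j).2)⟩) := by
          refine Prod.ext ?_ (Subtype.ext ?_)
          · rw [hx1, hα, map_add]
            rfl
          · rw [hx2, hβ, map_add]
            rfl
        rw [hsum]
        exact Submodule.add_mem _ (key i hi s _ rfl rfl) (key j hj t _ rfl rfl))

end Constructions

/-! ### Explicit interval systems for six indeterminates -/

section LowerBounds

/-- The subset of `Fin 6` with binary characteristic function `m`. -/
def bitSet (m : ℕ) : Finset (Fin 6) := Finset.univ.filter fun i => m.testBit i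

/-- Intervals partitioning the nonempty subsets of `Fin 6`. -/
def maxIdealIntervals : Fin 20 → ℕ × ℕ :=
  ![(1, 7), (2, 14), (4, 28), (8, 25), (16, 19), (32, 35), (36, 37), (40, 41), (48, 49),
    (11, 63), (13, 61), (21, 55), (22, 62), (26, 58), (38, 39), (42, 46), (44, 60), (50, 51),
    (52, 52), (56, 57)]

/-- Intervals, marked with one of three vectors, covering the nonempty subsets of `Fin 6`
twice and the empty set once. -/
def prodIntervals : Fin 33 → ℕ × ℕ × Fin 3 :=
  ![(0, 15, 0), (16, 60, 0), (16, 27, 1), (32, 45, 2), (32, 51, 1), (1, 23, 2), (2, 58, 2),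
    (4, 54, 1), (8, 45, 1), (37, 39, 1), (11, 43, 2), (22, 54, 0), (38, 46, 2), (14, 30, 2),
    (28, 29, 1), (21, 23, 1), (35, 39, 2), (56, 57, 2), (25, 57, 0), (49, 51, 2), (42, 46, 0),
    (15, 31, 1), (27, 31, 0), (29, 61, 0), (30, 62, 0), (43, 47, 0), (53, 55, 0), (53, 55, 1),
    (58, 59, 0), (60, 61, 1), (47, 63, 1), (59, 63, 2), (62, 62, 1)]

/-- Three pairwise linearly independent vectors in the plane. -/
def planeVector (K : Type*) [Field K] : Fin 3 → K × K := ![(1, 0), (0, 1), (1, 1)]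

theorem planeVector_det_ne_zero (K : Type*) [Field K] {a b : Fin 3} (h : a ≠ b) :
    (planeVector K a).1 * (planeVector K b).2 - (planeVector K a).2 * (planeVector K b).1 ≠ 0 := by
  fin_cases a <;> fin_cases b <;> simp [planeVector] at h ⊢

set_option maxRecDepth 100000 in
theorem maxIdealIntervals_cover : ∀ S : Finset (Fin 6), S ≠ ∅ →
    ∃ i, Covers (bitSet (maxIdealIntervals i).1) (bitSet (maxIdealIntervals i).2) S ∧
      ∀ k, Covers (bitSet (maxIdealIntervals k).1) (bitSet (maxIdealIntervals k).2) S → k = i := by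
  decide +kernel

-- Exactly two intervals contain `S`, and different marks suffice for independence by
-- `planeVector_det_ne_zero`. The check is thus purely combinatorial and independent of `K`.
set_option maxRecDepth 100000 in
theorem prodIntervals_cover : ∀ S : Finset (Fin 6), S ≠ ∅ →
    ∃ i, Covers (bitSet (prodIntervals i).1) (bitSet (prodIntervals i).2.1) S ∧
    ∃ j, Covers (bitSet (prodIntervals j).1) (bitSet (prodIntervals j).2.1) S ∧
      (prodIntervals i).2.2 ≠ (prodIntervals j).2.2 ∧
      ∀ k, Covers (bitSet (prodIntervals k).1) (bitSet (prodIntervals k).2.1) S →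
        k = i ∨ k = j := by
  decide +kernel

theorem le_sdepth_maxIdeal (K : Type*) [Field K] :
    3 ≤ sdepth (idealGrading (maxIdeal K 6) (maxIdeal_isMonomialIdeal K 6)) := by
  let D := maxIdealStanleyDecomposition K (fun k => bitSet (maxIdealIntervals k).1)
    (fun k => bitSet (maxIdealIntervals k).2) (by decide +kernel) (by decide +kernel)
    maxIdealIntervals_cover
  refine le_trans ?_ (le_iSup _ D)
  have h : ∀ k, 3 ≤ (bitSet (maxIdealIntervals k).2).card := by decide +kernel
  exact le_iInf fun k => by exact_mod_cast h k

theorem le_sdepth_poly_prod_maxIdeal (K : Type*) [Field K] :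
    4 ≤ sdepth ((polyGrading K 6).prod
      (idealGrading (maxIdeal K 6) (maxIdeal_isMonomialIdeal K 6))) := by
  have hA : ∀ k, bitSet (prodIntervals k).1 = ∅ → (prodIntervals k).2.2 = 0 := by
    decide +kernel
  have h0 : Covers (bitSet (prodIntervals 0).1) (bitSet (prodIntervals 0).2.1) ∅ ∧
      ∀ k, Covers (bitSet (prodIntervals k).1) (bitSet (prodIntervals k).2.1) ∅ → k = 0 := by
    decide +kernel
  let D := polyProdMaxIdealStanleyDecomposition (K := K) (fun k => bitSet (prodIntervals k).1)
    (fun k => bitSet (prodIntervals k).2.1) (fun k => planeVector K (prodIntervals k).2.2)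
    (by decide +kernel)
    (fun k hk => by rw [hA k hk]; rfl)
    -- Interval `0` begins at the empty set and carries `(1, 0)`, so its generator is `(1, 0)` in `R
    -- ⊕ m`.
    ⟨0, one_ne_zero, h0⟩
    (fun S hS => by
      obtain ⟨i, hi, j, hj, hij, hall⟩ := prodIntervals_cover S hS
      exact ⟨i, j, planeVector_det_ne_zero K hij, hi, hj, hall⟩)
  refine le_trans ?_ (le_iSup _ D)
  have h : ∀ k, 4 ≤ (bitSet (prodIntervals k).2.1).card := by decide +kernel
  exact le_iInf fun k => by exact_mod_cast h k

end LowerBounds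

end Multigraded

end

/-! ### The depths for six indeterminates and the negative answer -/

theorem mainTheorem3 (K : Type*) [Field K] :
    (Multigraded.sdepth ((Multigraded.polyGrading K 6).prod
        (Multigraded.idealGrading (Multigraded.maxIdeal K 6)
          (Multigraded.maxIdeal_isMonomialIdeal K 6))) = 4 ∧
      Multigraded.hdepth ((Multigraded.polyGrading K 6).prod
        (Multigraded.idealGrading (Multigraded.maxIdeal K 6)
          (Multigraded.maxIdeal_isMonomialIdeal K 6))) = 4) ∧
    (Multigraded.sdepth (Multigraded.idealGrading (Multigraded.maxIdeal K 6)
        (Multigraded.maxIdeal_isMonomialIdeal K 6)) = 3 ∧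
      Multigraded.hdepth (Multigraded.idealGrading (Multigraded.maxIdeal K 6)
        (Multigraded.maxIdeal_isMonomialIdeal K 6)) = 3) ∧
    ¬ ∀ (n : ℕ) (I : Ideal (MvPolynomial (Fin n) K)) (hI : Multigraded.IsMonomialIdeal I),
        I ≠ ⊥ →
        Multigraded.sdepth ((Multigraded.polyGrading K n).prod
          (Multigraded.idealGrading I hI)) =
        Multigraded.sdepth (Multigraded.idealGrading I hI) := by
  have hp := Multigraded.le_sdepth_poly_prod_maxIdeal K
  have hp' := Multigraded.hdepth_poly_prod_maxIdeal_le K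
  have hm := Multigraded.le_sdepth_maxIdeal K
  have hm' := Multigraded.hdepth_maxIdeal_le K
  have hps := Multigraded.sdepth_le_hdepth ((Multigraded.polyGrading K 6).prod
    (Multigraded.idealGrading _ (Multigraded.maxIdeal_isMonomialIdeal K 6)))
  have hms := Multigraded.sdepth_le_hdepth
    (Multigraded.idealGrading _ (Multigraded.maxIdeal_isMonomialIdeal K 6))
  have hp4 := le_antisymm (hps.trans hp') hp
  have hm3 := le_antisymm (hms.trans hm') hm
  refine ⟨⟨hp4, le_antisymm hp' (hp.trans hps)⟩, ⟨hm3, le_antisymm hm' (hm.trans hms)⟩,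
    fun h => ?_⟩
  have h1 := h 6 _ (Multigraded.maxIdeal_isMonomialIdeal K 6) fun h0 => ?_
  · rw [hp4, hm3] at h1
    exact absurd h1 (by decide)
  · have hX : (MvPolynomial.X 0 : MvPolynomial (Fin 6) K) ∈ Multigraded.maxIdeal K 6 :=
      Ideal.subset_span ⟨0, rfl⟩
    rw [h0] at hX
    exact MvPolynomial.X_ne_zero (R := K) (0 : Fin 6) hX
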